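/- A quantum graph $G$ is a pair of a finite-dimensional complex inner product space $V(G)$ and a real vector space $E(G)$ of self-adjoint operators on $V(G)$ that contains the identity $I$. Write $|G|=\dim_{\mathbb C}V(G)$ (the order) and $\|G\|=\dim_{\mathbb R}E(G)-1$ (the valence). A code of $G$ is a subspace $C\subseteq V(G)$ such that, for some function $\epsilon\colon E(G)\to\mathbb R$, one has $P_CAP_C=\epsilon(A)P_C$ for all $A\in E(G)$, where $P_C$ is the orthogonal projection onto $C$. A coloring of $G$ is a finite set $K$ of codes with $\sum_{C\in K}P_C=I$. Let $\alpha(G)$ be the largest dimension of a code of $G$, let $\chi(G)$ be the smallest cardinality of a coloring of $G$, and let $\chi(n,m)$ be the maximum of $\chi(G)$ over all quantum graphs $G$ with $|G|=n$ and $\|G\|=m$. For integers $n,m\ge 0$, denote by $Q_{n,m}$ any quantum graph of order $n$ and valence $m$ whose edge space is commutative and has a basis $I,A_1,\dots,A_m$ such that each $A_i$ has an orthonormal basis of eigenvectors $w_{i,1},\dots,w_{i,n}$ with eigenvalues $\lambda_{i,1},\dots,\lambda_{i,n}$ satisfying - (tropical) $0<\lambda_{i,j+1}<\lambda_{i,j}/n^2$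 for $1\le i\le m$ and $1\le j<n$; - (cyclical) $w_{i+1,j}=w_{i,\,j+\lfloor n/m\rfloor+\delta_i}$ for $1\le i<m$ and $1\le j\le n$, where $\delta_i=1$ if $i\le n\bmod m$ and $\delta_i=0$ otherwise, and the second index is read modulo $n$. Define the step logarithm by $\operatorname{slog}(0,q)=0$ and $\operatorname{slog}(p,q)=\operatorname{slog}(p-\lceil p/q\rceil,q)+1$ for positive integers $p,q$. Then: 1. For all integers $0\le m<n$ a graph $Q_{n,m}$ exists, and every graph $Q_{n,m}$ satisfies $\alpha(Q_{n,m})=\lceil n/(m+1)\rceil$. 2. For every integer $n\ge 2$, $\chi(n,1)=\operatorname{slog}(n,2)=\lfloor\log_2 n\rfloor+1$, and this maximum is attained by every graph $Q_{n,1}$. In particular, quantum graphs of valence $1$ have unbounded chromatic number. -/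

import Mathlib

universe u

/-- A quantum graph: a finite dimensional complex inner product space `V` together with a real
vector space `E` of self-adjoint operators on `V` that contains the identity. -/
structure QuantumGraph where
  /-- The vertex space. -/
  V : Type u
  [normedAddCommGroup : NormedAddCommGroup V]
  [innerProductSpace : InnerProductSpace ℂ V]
  [finiteDimensional : FiniteDimensional ℂ V]
  /-- The edge space. -/
  E : Submodule ℝ (V →ₗ[ℂ] V)
  isSymmetric_of_mem : ∀ A ∈ E, A.IsSymmetric
  id_mem : LinearMap.id ∈ E

attribute [instance] QuantumGraph.normedAddCommGroup QuantumGraph.innerProductSpace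
  QuantumGraph.finiteDimensional

namespace QuantumGraph

/-- The order of `G`: the dimension of the vertex space. -/
noncomputable def order (G : QuantumGraph.{u}) : ℕ := Module.finrank ℂ G.V

/-- The valence of `G`: one less than the real dimension of the edge space. (The subtraction
truncates only on the zero vertex space.) -/
noncomputable def valence (G : QuantumGraph.{u}) : ℕ := Module.finrank ℝ G.E - 1

/-- The orthogonal projection onto `C`, as an operator on the vertex space. -/
noncomputable def proj (G : QuantumGraph.{u}) (C : Submodule ℂ G.V) : G.V →ₗ[ℂ] G.V :=
  (C.starProjection : G.V →ₗ[ℂ] G.V)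

/-- A code of `G`: a subspace `C` with `P A P = ε(A) P` for all `A` in the edge space and some
real-valued function `ε`, where `P` is the orthogonal projection onto `C`. -/
def IsCode (G : QuantumGraph.{u}) (C : Submodule ℂ G.V) : Prop :=
  ∃ ε : G.E → ℝ, ∀ A : G.E,
    G.proj C ∘ₗ (A : G.V →ₗ[ℂ] G.V) ∘ₗ G.proj C = ((ε A : ℝ) : ℂ) • G.proj C

/-- A coloring of `G`: a set of codes whose projections sum to the identity. -/
def IsColoring (G : QuantumGraph.{u}) (K : Finset (Submodule ℂ G.V)) : Prop :=
  (∀ C ∈ K, G.IsCode C) ∧ ∑ C ∈ K, G.proj C = LinearMap.id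

/-- The independence number: the dimension of the largest code. -/
noncomputable def independenceNumber (G : QuantumGraph.{u}) : ℕ :=
  sSup {d : ℕ | ∃ C : Submodule ℂ G.V, G.IsCode C ∧ Module.finrank ℂ C = d}

/-- The chromatic number: the cardinality of the smallest coloring. -/
noncomputable def chromaticNumber (G : QuantumGraph.{u}) : ℕ :=
  sInf {k : ℕ | ∃ K : Finset (Submodule ℂ G.V), G.IsColoring K ∧ K.card = k}

/-- The chromatic numbers of all quantum graphs of order `n` and valence `m`. -/
def chromaticNumbers (n m : ℕ) : Set ℕ :=
  {k | ∃ G : QuantumGraph.{u}, G.order = n ∧ G.valence = m ∧ G.chromaticNumber = k}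

/-- `G` is one of the graphs `Q_{n,m}`: it has order `n`, valence `m` and a commutative edge space
with a basis `I, A₀, …, A_{m-1}` that is tropical and cyclical. Here `lam i j` and `w i j` are
the `j`-th eigenvalue and the `j`-th (normalized) eigenvector of `A i`; all indices start at `0`. -/
def IsQ (G : QuantumGraph.{u}) (n m : ℕ) : Prop :=
  G.order = n ∧ G.valence = m ∧
  (∀ A ∈ G.E, ∀ B ∈ G.E, A ∘ₗ B = B ∘ₗ A) ∧
  ∃ (A : Fin m → (G.V →ₗ[ℂ] G.V)) (lam : Fin m → Fin n → ℝ)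
    (w : Fin m → OrthonormalBasis (Fin n) ℂ G.V),
    -- the identity and the `A i` form a basis of the edge space
    LinearIndependent ℝ (Fin.cons LinearMap.id A : Fin (m + 1) → (G.V →ₗ[ℂ] G.V)) ∧
    Submodule.span ℝ (Set.range (Fin.cons LinearMap.id A : Fin (m + 1) → (G.V →ₗ[ℂ] G.V))) = G.E ∧
    -- eigenvalues and eigenvectors
    (∀ i j, A i (w i j) = ((lam i j : ℝ) : ℂ) • w i j) ∧
    -- tropical
    (∀ (i : Fin m) (j j' : Fin n), (j' : ℕ) = j + 1 →
      0 < lam i j' ∧ lam i j' < lam i j / (n : ℝ) ^ 2) ∧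
    -- cyclical
    (∀ (i i' : Fin m) (j j' : Fin n), (i' : ℕ) = i + 1 →
      (j' : ℕ) = (j + n / m + if (i : ℕ) < n % m then 1 else 0) % n →
      w i' j = w i j')

end QuantumGraph

/-- The step logarithm: `slog 0 q = 0` and `slog p q = slog (p - ⌈p / q⌉) q + 1` for positive
`p` and `q`. (The value for `q = 0` is a dummy.) -/
noncomputable def slog (p q : ℕ) : ℕ :=
  if h : 0 < p ∧ 0 < q then slog (p - ⌈(p : ℚ) / q⌉₊) q + 1 else 0
termination_by p
decreasing_by
  have hp : (0 : ℚ) < p := by exact_mod_cast h.1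
  have hq : (0 : ℚ) < q := by exact_mod_cast h.2
  have hc : 0 < ⌈(p : ℚ) / q⌉₊ := Nat.ceil_pos.mpr (div_pos hp hq)
  omega

/-!
On the span of unit vectors with pairwise disjoint supports in a common eigenbasis, an edge acts as
a scalar if it has the same mean value on each of them. A Tverberg point of the eigenvalue vectors
provides `r + 1` such unit vectors whenever `r * (m + 1) < n`. At valence one this yields a code of
half the dimension of any subspace, rounded up, and splitting off such codes one after another
colors the graph with `slog n 2` codes.

In the opposite direction, let a code have dimension greater than `r`. If the eigenvalues of an edge
are tropical, then a vector `v` of the code has squared coordinates less than `‖v‖ ^ 2 / n` at the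
first `r` eigenvectors of that edge. By the cyclic shifts, all but at most `r` members of the common
eigenbasis are of this kind for some edge, so a vector that vanishes at the remaining ones is too
short. For a coloring, the tropical condition shows that each proper subset `T` leaves out a code of
dimension at most one more than the sum of the dimensions in `T`; hence `k` codes cover dimension at
most `2 ^ k - 1`.

The graphs `Q_{n,m}` are obtained from cyclic shifts of a geometric progression.
-/

open scoped InnerProductSpace

section Convexity

theorem norm_sq_le_inner_of_isMinOn_norm {E : Type*} [NormedAddCommGroup E]
    [InnerProductSpace ℝ E] {s : Set E} (hs : Convex ℝ s) {p : E} (hp : p ∈ s)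
    (hmin : IsMinOn norm s p) {q : E} (hq : q ∈ s) : ‖p‖ ^ 2 ≤ ⟪p, q⟫_ℝ := by
  have : Nonempty s := ⟨⟨p, hp⟩⟩
  have hinf : ‖0 - p‖ = ⨅ x : s, ‖0 - (x : E)‖ := by
    simp only [zero_sub, norm_neg]
    exact le_antisymm (le_ciInf fun x => hmin x.2)
      (ciInf_le ⟨0, Set.forall_mem_range.2 fun _ => norm_nonneg _⟩ (⟨p, hp⟩ : s))
  have h := (norm_eq_iInf_iff_real_inner_le_zero hs hp).mp hinf q hq
  rw [zero_sub, inner_neg_left, inner_sub_right, real_inner_self_eq_norm_sq] at h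
  linarith

theorem exists_inner_nonpos_of_zero_mem_convexHull {E : Type*} [NormedAddCommGroup E]
    [InnerProductSpace ℝ E] {s : Set E} (hs : (0 : E) ∈ convexHull ℝ s) (p : E) :
    ∃ q ∈ s, ⟪p, q⟫_ℝ ≤ 0 := by
  by_contra! hpos
  have hsub : convexHull ℝ s ⊆ {q | 0 < ⟪p, q⟫_ℝ} :=
    convexHull_min hpos (convex_halfSpace_gt (innerₗ E p).isLinear 0)
  simpa using hsub hs

variable {E : Type*} [AddCommGroup E] [Module ℝ E]

theorem linearIndependent_of_affineIndependent_of_map_eq {ι : Type*} {z : ι → E}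
    (hz : AffineIndependent ℝ z) (φ : E →ₗ[ℝ] ℝ) {c : ℝ} (hc : c ≠ 0) (hφ : ∀ i, φ (z i) = c) :
    LinearIndependent ℝ z := by
  rw [linearIndependent_iff']
  intro s a ha
  have hsum : ∑ i ∈ s, a i = 0 := by
    have h := congrArg φ ha
    simp only [map_sum, map_smul, hφ, smul_eq_mul, map_zero, ← Finset.sum_mul] at h
    exact (mul_eq_zero.mp h).resolve_right hc
  exact affineIndependent_iff.mp hz s a hsum ha

theorem exists_mem_convexHull_image_compl_singleton [FiniteDimensional ℝ E] {J : Type*}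
    [Fintype J] (hJ : Module.finrank ℝ E < Fintype.card J) {z : J → E} {p : E}
    (hp : p ∈ convexHull ℝ (Set.range z)) (φ : E →ₗ[ℝ] ℝ) (hφp : φ p ≠ 0)
    (hφ : ∀ j, φ p ≤ φ (z j)) : ∃ j, p ∈ convexHull ℝ (z '' {j}ᶜ) := by
  obtain ⟨ι, _, y, c, hy, hind, hcpos, hc1, hcy⟩ := eq_pos_convex_span_of_mem_convexHull hp
  choose g hg using fun i => hy ⟨i, rfl⟩
  have hφy : ∀ i, φ (y i) = φ p := by
    have hsum : ∑ i, c i * φ p = ∑ i, c i * φ (y i) := by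
      rw [← Finset.sum_mul, hc1, one_mul, ← hcy]
      simp only [map_sum, map_smul, smul_eq_mul]
    have hle : ∀ i ∈ Finset.univ, c i * φ p ≤ c i * φ (y i) := fun i _ =>
      mul_le_mul_of_nonneg_left (hg i ▸ hφ (g i)) (hcpos i).le
    exact fun i => (mul_left_cancel₀ (hcpos i).ne'
      ((Finset.sum_eq_sum_iff_of_le hle).mp hsum i (Finset.mem_univ i))).symm
  have hcard : Fintype.card ι < Fintype.card J :=
    (linearIndependent_of_affineIndependent_of_map_eq hind φ hφp
      hφy).fintype_card_le_finrank.trans_lt hJ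
  obtain ⟨j, hj⟩ : ∃ j, ∀ i, g i ≠ j := by
    by_contra! h
    exact hcard.not_ge (Fintype.card_le_of_surjective g h)
  refine ⟨j, ?_⟩
  rw [← hcy]
  exact (convex_convexHull ℝ _).sum_mem (fun i _ => (hcpos i).le) hc1 fun i _ =>
    subset_convexHull ℝ _ ⟨g i, hj i, hg i⟩

/- Bárány's argument: among all rainbow hulls take the point `p` closest to the origin. If `p ≠ 0`,
then `p` lies on a face that misses some color `j`, and exchanging the point of color `j` for one
in the half space `⟪p, ·⟫ ≤ 0` gives a rainbow hull that contains `p` but not as its closest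
point. -/
theorem colorful_caratheodory_of_innerProductSpace {E J K : Type*} [NormedAddCommGroup E]
    [InnerProductSpace ℝ E] [FiniteDimensional ℝ E] [Fintype J] [Finite K]
    (hJ : Module.finrank ℝ E < Fintype.card J) {y : J → K → E}
    (hy : ∀ j, (0 : E) ∈ convexHull ℝ (Set.range (y j))) :
    ∃ f : J → K, (0 : E) ∈ convexHull ℝ (Set.range fun j => y j (f j)) := by
  classical
  let hull (f : J → K) : Set E := convexHull ℝ (Set.range fun j => y j (f j))
  have hcompact : IsCompact (⋃ f, hull f) :=
    isCompact_iUnion fun f => (Set.finite_range _).isCompact_convexHull (𝕜 := ℝ)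
  have hnonempty : (⋃ f, hull f).Nonempty := by
    have : Nonempty J := Fintype.card_pos_iff.mp (Nat.zero_lt_of_lt hJ)
    have hK (j : J) : Nonempty K :=
      Set.range_nonempty_iff_nonempty.mp (convexHull_nonempty_iff.mp ⟨0, hy j⟩)
    exact Set.nonempty_iUnion.mpr
      ⟨fun j => (hK j).some, (Set.range_nonempty _).convexHull⟩
  obtain ⟨p, hp, hmin⟩ := hcompact.exists_isMinOn hnonempty continuous_norm.continuousOn
  have hinner : ∀ g, p ∈ hull g → ∀ q ∈ hull g, ‖p‖ ^ 2 ≤ ⟪p, q⟫_ℝ := fun g hpg q hq =>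
    norm_sq_le_inner_of_isMinOn_norm (convex_convexHull ℝ _) hpg
      (hmin.on_subset (Set.subset_iUnion hull g)) hq
  obtain ⟨f, hpf⟩ := Set.mem_iUnion.mp hp
  refine ⟨f, ?_⟩
  by_contra h0
  have hp0 : p ≠ 0 := fun h => h0 (h ▸ hpf)
  obtain ⟨j, hj⟩ : ∃ j, p ∈ convexHull ℝ ((fun j => y j (f j)) '' {j}ᶜ) := by
    refine exists_mem_convexHull_image_compl_singleton hJ hpf (innerₗ E p) ?_ fun j => ?_
    · simpa using hp0
    · simpa using hinner f hpf _ (subset_convexHull ℝ _ ⟨j, rfl⟩)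
  obtain ⟨_, ⟨k, rfl⟩, hk⟩ := exists_inner_nonpos_of_zero_mem_convexHull (hy j) p
  have hpg : p ∈ hull (Function.update f j k) := by
    refine convexHull_mono ?_ hj
    rintro _ ⟨i, hi, rfl⟩
    exact ⟨i, by simp only [Function.update_of_ne hi]⟩
  have hkg : y j k ∈ hull (Function.update f j k) :=
    subset_convexHull ℝ _ ⟨j, by simp only [Function.update_self]⟩
  have hle := (hinner _ hpg _ hkg).trans hk
  exact hp0 (by simpa using hle)

theorem colorful_caratheodory [FiniteDimensional ℝ E] {J K : Type*} [Fintype J]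
    [Finite K] (hJ : Module.finrank ℝ E < Fintype.card J) {y : J → K → E}
    (hy : ∀ j, (0 : E) ∈ convexHull ℝ (Set.range (y j))) :
    ∃ f : J → K, (0 : E) ∈ convexHull ℝ (Set.range fun j => y j (f j)) := by
  let L : E ≃ₗ[ℝ] EuclideanSpace ℝ (Fin (Module.finrank ℝ E)) :=
    (Module.finBasis ℝ E).equivFun ≪≫ₗ (WithLp.linearEquiv 2 ℝ _).symm
  have himage (s : Set E) : 0 ∈ convexHull ℝ (L '' s) ↔ 0 ∈ convexHull ℝ s := by
    rw [← L.coe_coe, ← LinearMap.image_convexHull]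
    simp
  obtain ⟨f, hf⟩ := colorful_caratheodory_of_innerProductSpace (y := fun j k => L (y j k))
    (by simpa using hJ) fun j => by
      rw [Set.range_comp' L (y j)]
      exact (himage _).mpr (hy j)
  refine ⟨f, (himage _).mp ?_⟩
  rwa [← Set.range_comp']

theorem mem_convexHull_image_iff {ι : Type*} [Fintype ι] {x : ι → E} {s : Set ι} {p : E} :
    p ∈ convexHull ℝ (x '' s) ↔ ∃ c : ι → ℝ, (∀ i, 0 ≤ c i) ∧ (∀ i ∉ s, c i = 0) ∧
      ∑ i, c i = 1 ∧ ∑ i, c i • x i = p := by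
  classical
  constructor
  · intro hp
    obtain ⟨κ, _, a, z, ha0, ha1, hz, rfl⟩ := mem_convexHull_iff_exists_fintype.mp hp
    choose g hgs hgz using hz
    refine ⟨fun i => ∑ k with g k = i, a k, fun i => Finset.sum_nonneg fun k _ => ha0 k,
      fun i hi => ?_, ?_, ?_⟩
    · refine Finset.sum_eq_zero fun k hk => absurd (hgs k) ?_
      rwa [(Finset.mem_filter.mp hk).2]
    · exact (Finset.sum_fiberwise _ g a).trans ha1
    · simp only [Finset.sum_smul]
      rw [← Finset.sum_fiberwise (s := Finset.univ) (g := g)]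
      refine Finset.sum_congr rfl fun i _ => Finset.sum_congr rfl fun k hk => ?_
      rw [← hgz k, (Finset.mem_filter.mp hk).2]
  · rintro ⟨c, hc0, hcs, hc1, rfl⟩
    have hsupp : ∀ i, c i ≠ 0 → i ∈ s := fun i => not_imp_comm.mp (hcs i)
    rw [← Finset.sum_filter_of_ne (p := (· ∈ s)) fun i _ hi =>
      hsupp i fun h => hi (by rw [h, zero_smul])]
    rw [← Finset.sum_filter_of_ne (p := (· ∈ s)) fun i _ hi => hsupp i hi] at hc1
    exact (convex_convexHull ℝ _).sum_mem (fun i _ => hc0 i) hc1 fun i hi =>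
      subset_convexHull ℝ _ (Set.mem_image_of_mem x (Finset.mem_filter.mp hi).2)

theorem zero_mem_convexHull_range_of_sum_eq_zero {κ : Type*} [Fintype κ] [Nonempty κ]
    {y : κ → E} (hy : ∑ k, y k = 0) : (0 : E) ∈ convexHull ℝ (Set.range y) := by
  rw [← Set.image_univ, mem_convexHull_image_iff]
  refine ⟨fun _ => (Fintype.card κ : ℝ)⁻¹, fun _ => by positivity, by simp, by simp, ?_⟩
  rw [← Finset.smul_sum, hy, smul_zero]

/- Sarkaria's trick: apply colorful Carathéodory to the tensors `v k ⊗ X j`, where the only linear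
relation between the vectors `v 0, …, v r` is that their sum is zero. Here `v 0 = -(1, …, 1)` and
`v a.succ` is the `a`-th standard basis vector. -/
theorem exists_partition_sum_smul_eq [FiniteDimensional ℝ E] {ι : Type*} [Fintype ι] {r : ℕ}
    (X : ι → E) (hr : r * Module.finrank ℝ E < Fintype.card ι) :
    ∃ (f : ι → Fin (r + 1)) (c : ι → ℝ) (p : E), (∀ j, 0 ≤ c j) ∧ ∑ j, c j = 1 ∧
      ∀ k, ∑ j with f j = k, c j • X j = p := by
  classical
  let y (j : ι) : Fin (r + 1) → Fin r → E := Fin.cons (-fun _ => X j) fun a => Pi.single a (X j)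
  have hy : ∀ j, ∑ k, y j k = 0 := fun j => by
    rw [Fin.sum_univ_succ]
    simp only [y, Fin.cons_zero, Fin.cons_succ, Finset.univ_sum_single]
    exact neg_add_cancel _
  obtain ⟨f, hf⟩ := colorful_caratheodory (y := y)
    (by simpa [Module.finrank_pi_fintype] using hr)
    fun j => zero_mem_convexHull_range_of_sum_eq_zero (hy j)
  rw [← Set.image_univ, mem_convexHull_image_iff] at hf
  obtain ⟨c, hc0, -, hc1, hcy⟩ := hf
  refine ⟨f, c, ∑ j with f j = 0, c j • X j, hc0, hc1, Fin.cases rfl fun a => ?_⟩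
  have hterm : ∀ j, c j • y j (f j) a =
      (if f j = a.succ then c j • X j else 0) - if f j = 0 then c j • X j else 0 := by
    intro j
    refine Fin.cases ?_ (fun b => ?_) (f j)
    · simp [y, (Fin.succ_ne_zero a).symm]
    · rcases eq_or_ne b a with rfl | hb
      · simp [y]
      · simp [y, hb]
  have ha := congrFun hcy a
  simp only [Finset.sum_apply, Pi.smul_apply, hterm, Finset.sum_sub_distrib, Pi.zero_apply,
    ← Finset.sum_filter] at ha
  exact sub_eq_zero.mp ha

theorem tverberg_partition [FiniteDimensional ℝ E] {ι : Type*}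
    [Fintype ι] {r : ℕ} (x : ι → E) (hr : r * (Module.finrank ℝ E + 1) < Fintype.card ι) :
    ∃ f : ι → Fin (r + 1), (⋂ k, convexHull ℝ (x '' (f ⁻¹' {k}))).Nonempty := by
  classical
  obtain ⟨f, c, p, hc0, hc1, hp⟩ := exists_partition_sum_smul_eq (fun j => (x j, (1 : ℝ)))
    (by simpa using hr)
  have hmass (k : Fin (r + 1)) : ∑ j with f j = k, c j = p.2 := by simp [← hp k, Prod.snd_sum]
  have hp2 : (r + 1) * p.2 = 1 := by
    simpa [hmass] using (Finset.sum_fiberwise _ f c).trans hc1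
  refine ⟨f, (r + 1 : ℝ) • p.1, Set.mem_iInter.mpr fun k => mem_convexHull_image_iff.mpr
    ⟨fun j => if f j = k then (r + 1) * c j else 0, fun j => ?_, fun j hj => if_neg hj, ?_, ?_⟩⟩
  · have := hc0 j
    positivity
  · rw [← Finset.sum_filter, ← Finset.mul_sum, hmass, hp2]
  · simp only [← hp k, ite_smul, zero_smul, ← Finset.sum_filter, mul_smul, ← Finset.smul_sum]
    simp [Prod.fst_sum]

end Convexity

theorem slog_zero (q : ℕ) : slog 0 q = 0 := by
  rw [slog]
  simp

theorem slog_two {p : ℕ} (hp : 0 < p) : slog p 2 = slog (p / 2) 2 + 1 := by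
  have hceil : ⌈(p : ℚ) / 2⌉₊ = p - p / 2 := by
    rw [Nat.ceil_eq_iff (by omega), lt_div_iff₀ two_pos, div_le_iff₀ two_pos]
    constructor
    · exact_mod_cast (by omega : (p - p / 2 - 1) * 2 < p)
    · exact_mod_cast (by omega : p ≤ (p - p / 2) * 2)
  rw [slog, dif_pos ⟨hp, two_pos⟩, Nat.cast_ofNat, hceil, Nat.sub_sub_self (Nat.div_le_self p 2)]

theorem slog_two_eq_log {n : ℕ} (hn : 0 < n) : slog n 2 = Nat.log 2 n + 1 := by
  induction n using Nat.strong_induction_on with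
  | _ n ih =>
    rw [slog_two hn]
    rcases Nat.lt_or_ge n 2 with h | h
    · obtain rfl : n = 1 := by omega
      simp [slog_zero]
    · rw [ih (n / 2) (by omega) (by omega), Nat.log_of_one_lt_of_le one_lt_two h]

section Compression

variable {𝕜 V ι κ : Type*} [RCLike 𝕜] [NormedAddCommGroup V] [InnerProductSpace 𝕜 V]
  {A : V →ₗ[𝕜] V}

/-- The compression of `A` to the subspace `C` is the real scalar `e`. This is the condition
`P A P = e P` on the orthogonal projection `P` onto `C`, written as an identity of forms on `C`. -/
def CompressesToScalar (A : V →ₗ[𝕜] V) (C : Submodule 𝕜 V) (e : ℝ) : Prop :=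
  ∀ x ∈ C, ∀ y ∈ C, ⟪x, A y⟫_𝕜 = e * ⟪x, y⟫_𝕜

theorem compressesToScalar_span {S : Set V} {e : ℝ}
    (h : ∀ x ∈ S, ∀ y ∈ S, ⟪x, A y⟫_𝕜 = e * ⟪x, y⟫_𝕜) :
    CompressesToScalar A (Submodule.span 𝕜 S) e := by
  intro x hx y hy
  induction hx, hy using Submodule.span_induction₂ with
  | mem_mem x y hx hy => exact h x hx y hy
  | zero_left y _ => simp
  | zero_right x _ => simp
  | add_left x y z _ _ _ hxz hyz => rw [inner_add_left, inner_add_left, hxz, hyz, mul_add]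
  | add_right x y z _ _ _ hxy hxz =>
    rw [map_add, inner_add_right, inner_add_right, hxy, hxz, mul_add]
  | smul_left c x y _ _ hxy => rw [inner_smul_left, inner_smul_left, hxy, mul_left_comm]
  | smul_right c x y _ _ hxy =>
    rw [map_smul, inner_smul_right, inner_smul_right, hxy, mul_left_comm]

theorem inner_sum_sqrt_smul_map [Fintype ι] [DecidableEq ι] [DecidableEq κ] {u : ι → V}
    {lam : ι → ℝ}
    (hA : ∀ i j, ⟪u i, A (u j)⟫_𝕜 = if i = j then (lam i : 𝕜) else 0) {c : κ → ι → ℝ}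
    (hc0 : ∀ k j, 0 ≤ c k j) (hc : ∀ k l, k ≠ l → ∀ j, c k j = 0 ∨ c l j = 0) (k l : κ) :
    ⟪∑ j, (√(c k j) : 𝕜) • u j, A (∑ j, (√(c l j) : 𝕜) • u j)⟫_𝕜 =
      if k = l then ((∑ j, c k j * lam j : ℝ) : 𝕜) else 0 := by
  have h : ⟪∑ j, (√(c k j) : 𝕜) • u j, A (∑ j, (√(c l j) : 𝕜) • u j)⟫_𝕜 =
      ((∑ j, √(c k j) * √(c l j) * lam j : ℝ) : 𝕜) := by
    simp [sum_inner, inner_sum, inner_smul_left, inner_smul_right, hA, mul_assoc, mul_left_comm]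
  rw [h]
  split_ifs with hkl
  · subst hkl
    simp only [Real.mul_self_sqrt (hc0 k _)]
  · have hterm : ∀ j, √(c k j) * √(c l j) * lam j = 0 := fun j => by
      rcases hc k l hkl j with h0 | h0 <;> simp [h0]
    simp [hterm]

/- A Tverberg point of the vectors `(lam i j)_i`, written as a convex combination over each of the
`r + 1` parts, gives one unit vector `∑ j, √(c k j) • u j` per part `k`; on the span of these
vectors each `A i` compresses to the `i`-th coordinate of the point. -/
theorem exists_compressesToScalar_of_orthonormal [Fintype ι] [DecidableEq ι] [Fintype κ]
    {r : ℕ} {u : ι → V} (hu : Orthonormal 𝕜 u) (A : κ → V →ₗ[𝕜] V) (lam : κ → ι → ℝ)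
    (hA : ∀ i j k, ⟪u j, A i (u k)⟫_𝕜 = if j = k then (lam i j : 𝕜) else 0)
    (hr : r * (Fintype.card κ + 1) < Fintype.card ι) :
    ∃ C ≤ Submodule.span 𝕜 (Set.range u), Module.finrank 𝕜 C = r + 1 ∧
      ∀ i, ∃ e, CompressesToScalar (A i) C e := by
  obtain ⟨f, p, hp⟩ := tverberg_partition (r := r) (fun j i => lam i j) (by simpa using hr)
  choose c hc0 hcf hc1 hcp using fun k => mem_convexHull_image_iff.mp (Set.mem_iInter.mp hp k)
  have hdisj : ∀ k l, k ≠ l → ∀ j, c k j = 0 ∨ c l j = 0 := by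
    intro k l hkl j
    by_cases hj : f j = k
    · exact .inr (hcf l j fun h => hkl (hj.symm.trans h))
    · exact .inl (hcf k j hj)
  let z (k : Fin (r + 1)) : V := ∑ j, (√(c k j) : 𝕜) • u j
  have hz : Orthonormal 𝕜 z := orthonormal_iff_ite.mpr fun k l => by
    have h := inner_sum_sqrt_smul_map (𝕜 := 𝕜) (u := u) (A := .id) (lam := fun _ => 1)
      (by simpa [orthonormal_iff_ite] using hu) hc0 hdisj k l
    simpa [hc1] using h
  have hzA : ∀ i k l, ⟪z k, A i (z l)⟫_𝕜 = p i * ⟪z k, z l⟫_𝕜 := by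
    intro i k l
    have hpi : ∑ j, c k j * lam i j = p i := by
      simpa using congrFun (hcp k) i
    rw [inner_sum_sqrt_smul_map (hA i) hc0 hdisj, hpi, orthonormal_iff_ite.mp hz]
    simp
  refine ⟨Submodule.span 𝕜 (Set.range z), ?_, ?_, fun i => ⟨p i, compressesToScalar_span ?_⟩⟩
  · rw [Submodule.span_le]
    rintro _ ⟨k, rfl⟩
    exact Submodule.sum_mem _ fun j _ => Submodule.smul_mem _ _ (Submodule.subset_span ⟨j, rfl⟩)
  · simpa using finrank_span_eq_card hz.linearIndependent
  · rintro _ ⟨k, rfl⟩ _ ⟨l, rfl⟩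
    exact hzA i k l

variable [FiniteDimensional 𝕜 V]

theorem exists_compressesToScalar_finrank_eq_half (hA : A.IsSymmetric) {W : Submodule 𝕜 V}
    (hW : 0 < Module.finrank 𝕜 W) :
    ∃ C ≤ W, Module.finrank 𝕜 C = Module.finrank 𝕜 W - Module.finrank 𝕜 W / 2 ∧
      ∃ e, CompressesToScalar A C e := by
  let B : W →ₗ[𝕜] W := (W.orthogonalProjectionOnto : V →ₗ[𝕜] W) ∘ₗ A ∘ₗ W.subtype
  have hBA : ∀ x y : W, ⟪x, B y⟫_𝕜 = ⟪(x : V), A y⟫_𝕜 := fun x y =>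
    Submodule.inner_orthogonalProjectionOnto_eq_of_mem_left x (A y)
  have hB : B.IsSymmetric := fun x y => by
    rw [← inner_conj_symm, hBA, hBA, ← hA, inner_conj_symm]
  let b := hB.eigenvectorBasis rfl
  have hb : Orthonormal 𝕜 fun j => (b j : V) := b.orthonormal.comp_linearIsometry W.subtypeₗᵢ
  have hbA : ∀ j k, ⟪(b j : V), A (b k)⟫_𝕜 =
      if j = k then (hB.eigenvalues rfl j : 𝕜) else 0 := by
    intro j k
    rw [← hBA, hB.apply_eigenvectorBasis, inner_smul_right, orthonormal_iff_ite.mp b.orthonormal]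
    split_ifs with h <;> simp [h]
  obtain ⟨C, hC, hCd, hCe⟩ := exists_compressesToScalar_of_orthonormal
    (r := (Module.finrank 𝕜 W - 1) / 2) hb (fun _ : Unit => A) (fun _ => hB.eigenvalues rfl)
    (fun _ => hbA) (by simp only [Fintype.card_unit, Fintype.card_fin]; omega)
  refine ⟨C, hC.trans (Submodule.span_le.mpr ?_), by omega, hCe ()⟩
  rintro _ ⟨j, rfl⟩
  exact (b j).2

theorem starProjection_orthogonal_inf_of_le {C W : Submodule 𝕜 V} (h : C ≤ W) :
    (Cᗮ ⊓ W).starProjection = W.starProjection - C.starProjection := by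
  ext v
  refine Submodule.eq_starProjection_of_mem_orthogonal (Submodule.mem_inf.mpr ⟨?_, ?_⟩) ?_
  · have : W.starProjection v - C.starProjection v =
        (v - C.starProjection v) - (v - W.starProjection v) := by abel
    rw [sub_apply, this]
    exact Cᗮ.sub_mem (C.sub_starProjection_mem_orthogonal v)
      (Submodule.orthogonal_le h (W.sub_starProjection_mem_orthogonal v))
  · exact W.sub_mem (W.starProjection_apply_mem v) (h (C.starProjection_apply_mem v))
  · have : v - (W.starProjection v - C.starProjection v) =
        (v - W.starProjection v) + C.starProjection v := by abel
    rw [sub_apply, this]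
    exact Submodule.add_mem _
      (Submodule.orthogonal_le inf_le_right (W.sub_starProjection_mem_orthogonal v))
      (Submodule.orthogonal_le inf_le_left
        (C.le_orthogonal_orthogonal (C.starProjection_apply_mem v)))

theorem exists_sum_starProjection_eq_card_le_slog (hA : A.IsSymmetric) (W : Submodule 𝕜 V) :
    ∃ K : Finset (Submodule 𝕜 V), K.card ≤ slog (Module.finrank 𝕜 W) 2 ∧
      (∀ C ∈ K, C ≤ W ∧ ∃ e, CompressesToScalar A C e) ∧
      ∑ C ∈ K, C.starProjection = W.starProjection := by
  classical
  induction hd : Module.finrank 𝕜 W using Nat.strong_induction_on generalizing W with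
  | _ d ih =>
    rcases Nat.eq_zero_or_pos d with rfl | hd0
    · rw [Submodule.finrank_eq_zero] at hd
      exact ⟨∅, by simp, by simp, by simp [hd]⟩
    · obtain ⟨C, hCW, hC, hCe⟩ := exists_compressesToScalar_finrank_eq_half hA (hd ▸ hd0)
      have hCW' := Submodule.finrank_add_inf_finrank_orthogonal hCW
      obtain ⟨K, hK, hKe, hsum⟩ := ih (d / 2) (by omega) (Cᗮ ⊓ W) (by omega)
      have hCK : C ∉ K := fun h => by
        have hbot : C = ⊥ := C.isOrtho_self.mp ((hKe C h).1.trans inf_le_left)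
        rw [hbot, finrank_bot] at hC
        omega
      refine ⟨insert C K, ?_, Finset.forall_mem_insert _ _ _ |>.mpr ⟨⟨hCW, hCe⟩, fun D hD =>
        ⟨(hKe D hD).1.trans inf_le_right, (hKe D hD).2⟩⟩, ?_⟩
      · rw [Finset.card_insert_of_notMem hCK, slog_two hd0]
        omega
      · rw [Finset.sum_insert hCK, hsum, starProjection_orthogonal_inf_of_le hCW,
          add_sub_cancel]

end Compression

section Tropical

/-- A finite sequence is tropical with ratio `q` if each term is positive and is smaller than its
predecessor by a factor of more than `q`. The eigenvalues of the graphs `Q_{n,m}` have this property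
with `q = n ^ 2`. A sequence of length one is tropical whatever the sign of its term. -/
def IsTropical {n : ℕ} (q : ℝ) (lam : Fin n → ℝ) : Prop :=
  ∀ j j' : Fin n, (j' : ℕ) = j + 1 → 0 < lam j' ∧ lam j' < lam j / q

namespace IsTropical

variable {n : ℕ} {q : ℝ} {lam : Fin n → ℝ}

theorem pos_of_lt (h : IsTropical q lam) (hq : 0 < q) {a b : Fin n} (hab : a < b) (j : Fin n) :
    0 < lam j := by
  by_cases hj : (j : ℕ) + 1 < n
  · have hsucc := h j ⟨j + 1, hj⟩ rfl
    exact (div_pos_iff_of_pos_right hq).mp (hsucc.1.trans hsucc.2)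
  · exact (h ⟨j - 1, by omega⟩ j (by dsimp only; omega)).1

theorem antitone (h : IsTropical q lam) (hq : 1 ≤ q) : Antitone lam := by
  cases n with
  | zero => exact fun j => j.elim0
  | succ n =>
    refine Fin.antitone_iff_succ_le.mpr fun j => (h j.castSucc j.succ (by simp)).2.le.trans ?_
    exact div_le_self (h.pos_of_lt (by linarith) j.castSucc_lt_succ _).le hq

theorem lt_div (h : IsTropical q lam) (hq : 1 ≤ q) {j j' : Fin n} (hj : j < j') :
    lam j' < lam j / q :=
  (h.antitone hq (show ⟨j + 1, by omega⟩ ≤ j' from hj)).trans_lt (h j _ rfl).2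

end IsTropical

end Tropical

section Eigenbasis

variable {𝕜 V ι κ : Type*} [RCLike 𝕜] [NormedAddCommGroup V] [InnerProductSpace 𝕜 V]

theorem exists_compressesToScalar_of_eigenbasis [Fintype ι] [Fintype κ] {r : ℕ}
    {u : OrthonormalBasis ι 𝕜 V} {A : κ → V →ₗ[𝕜] V} {lam : κ → ι → ℝ}
    (hA : ∀ i p, A i (u p) = (lam i p : 𝕜) • u p)
    (hr : r * (Fintype.card κ + 1) < Fintype.card ι) :
    ∃ C : Submodule 𝕜 V, Module.finrank 𝕜 C = r + 1 ∧ ∀ i, ∃ e, CompressesToScalar (A i) C e := by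
  classical
  obtain ⟨C, -, hC⟩ := exists_compressesToScalar_of_orthonormal u.orthonormal A lam
    (fun i j k => by
      rw [hA, inner_smul_right, orthonormal_iff_ite.mp u.orthonormal]
      split_ifs with h <;> simp [h]) hr
  exact ⟨C, hC⟩

theorem re_inner_map_self_eq_sum [Fintype ι] (w : OrthonormalBasis ι 𝕜 V)
    {A : V →ₗ[𝕜] V} {lam : ι → ℝ} (hA : ∀ j, A (w j) = (lam j : 𝕜) • w j) (v : V) :
    RCLike.re ⟪v, A v⟫_𝕜 = ∑ j, lam j * ‖⟪w j, v⟫_𝕜‖ ^ 2 := by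
  have h : A v = ∑ j, (lam j * ⟪w j, v⟫_𝕜) • w j := by
    conv_lhs => rw [← w.sum_repr' v]
    simp only [map_sum, map_smul, hA, smul_smul, mul_comm]
  rw [h, inner_sum, map_sum]
  refine Finset.sum_congr rfl fun j _ => ?_
  rw [inner_smul_right, mul_assoc, ← inner_conj_symm v (w j), RCLike.mul_conj,
    RCLike.re_ofReal_mul]
  norm_cast

theorem CompressesToScalar.sum_mul_norm_inner_sq_eq [Fintype ι] {w : OrthonormalBasis ι 𝕜 V}
    {A : V →ₗ[𝕜] V} {lam : ι → ℝ} {C : Submodule 𝕜 V} {e : ℝ} (hC : CompressesToScalar A C e)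
    (hA : ∀ j, A (w j) = (lam j : 𝕜) • w j) {v : V} (hv : v ∈ C) :
    ∑ j, lam j * ‖⟪w j, v⟫_𝕜‖ ^ 2 = e * ‖v‖ ^ 2 := by
  rw [← re_inner_map_self_eq_sum w hA, hC v hv v hv, RCLike.re_ofReal_mul,
    inner_self_eq_norm_sq]

theorem sum_mul_norm_inner_sq_le [Fintype ι] {w : OrthonormalBasis ι 𝕜 V} {lam : ι → ℝ} {v : V}
    {c : ℝ} (h : ∀ j, ⟪w j, v⟫_𝕜 ≠ 0 → lam j ≤ c) :
    ∑ j, lam j * ‖⟪w j, v⟫_𝕜‖ ^ 2 ≤ c * ‖v‖ ^ 2 := by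
  rw [← w.sum_sq_norm_inner_right v, Finset.mul_sum]
  refine Finset.sum_le_sum fun j _ => ?_
  by_cases hj : ⟪w j, v⟫_𝕜 = 0
  · simp [hj]
  · exact mul_le_mul_of_nonneg_right (h j hj) (sq_nonneg _)

theorem le_sum_mul_norm_inner_sq [Fintype ι] {w : OrthonormalBasis ι 𝕜 V} {lam : ι → ℝ} {v : V}
    {c : ℝ} (h : ∀ j, ⟪w j, v⟫_𝕜 ≠ 0 → c ≤ lam j) :
    c * ‖v‖ ^ 2 ≤ ∑ j, lam j * ‖⟪w j, v⟫_𝕜‖ ^ 2 := by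
  have hneg := sum_mul_norm_inner_sq_le (w := w) (lam := -lam) fun j hj => neg_le_neg (h j hj)
  simpa using hneg

theorem sum_mul_norm_inner_sum_sq_le [Fintype ι] {w : ι → V} {lam : ι → ℝ} (hlam : ∀ j, 0 ≤ lam j)
    (S : Finset κ) (x : κ → V) :
    ∑ j, lam j * ‖⟪w j, ∑ k ∈ S, x k⟫_𝕜‖ ^ 2 ≤
      S.card * ∑ k ∈ S, ∑ j, lam j * ‖⟪w j, x k⟫_𝕜‖ ^ 2 := by
  rw [Finset.sum_comm, Finset.mul_sum]
  refine Finset.sum_le_sum fun j _ => ?_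
  rw [← Finset.mul_sum, mul_left_comm, inner_sum]
  refine mul_le_mul_of_nonneg_left ?_ (hlam j)
  calc ‖∑ k ∈ S, ⟪w j, x k⟫_𝕜‖ ^ 2 ≤ (∑ k ∈ S, ‖⟪w j, x k⟫_𝕜‖) ^ 2 := by
        gcongr
        exact norm_sum_le _ _
    _ ≤ S.card * ∑ k ∈ S, ‖⟪w j, x k⟫_𝕜‖ ^ 2 := sq_sum_le_card_mul_sum_sq

theorem exists_mem_ne_zero_forall_inner_eq_zero (g : ι → V) {s : Finset ι} {C : Submodule 𝕜 V}
    (hs : s.card < Module.finrank 𝕜 C) : ∃ v ∈ C, v ≠ 0 ∧ ∀ i ∈ s, ⟪g i, v⟫_𝕜 = 0 := by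
  have : FiniteDimensional 𝕜 C := Module.finite_of_finrank_pos (by omega)
  let F : C →ₗ[𝕜] s → 𝕜 := LinearMap.pi fun i => (innerₛₗ 𝕜 (g i)).comp C.subtype
  obtain ⟨v, hv, hv0⟩ := Submodule.exists_mem_ne_zero_of_ne_bot
    (LinearMap.ker_ne_bot_of_finrank_lt (f := F) (by simpa using hs))
  exact ⟨v, v.2, by simpa using hv0, fun i hi => congrFun hv ⟨i, hi⟩⟩

namespace CompressesToScalar

variable {n : ℕ} {w : OrthonormalBasis (Fin n) 𝕜 V} {A : V →ₗ[𝕜] V} {lam : Fin n → ℝ}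
  {C : Submodule 𝕜 V} {e : ℝ}

/- Some nonzero vector of the code is orthogonal to the first `j` eigenvectors. -/
theorem le_of_lt_finrank (hC : CompressesToScalar A C e)
    (hA : ∀ j, A (w j) = (lam j : 𝕜) • w j) (hlam : Antitone lam) {j : Fin n}
    (hj : (j : ℕ) < Module.finrank 𝕜 C) : e ≤ lam j := by
  obtain ⟨v, hvC, hv0, hv⟩ := exists_mem_ne_zero_forall_inner_eq_zero w
    (s := Finset.Iio j) (by simpa using hj)
  have h : e * ‖v‖ ^ 2 ≤ lam j * ‖v‖ ^ 2 := by
    rw [← hC.sum_mul_norm_inner_sq_eq hA hvC]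
    exact sum_mul_norm_inner_sq_le fun k hk =>
      hlam (not_lt.mp fun hkj => hk (hv k (Finset.mem_Iio.mpr hkj)))
  exact le_of_mul_le_mul_right h (by positivity)

theorem norm_inner_sq_lt (hC : CompressesToScalar A C e)
    (hA : ∀ j, A (w j) = (lam j : 𝕜) • w j) {q : ℝ} (hq : 1 ≤ q) (hlam : IsTropical q lam)
    {j k : Fin n} (hjk : j < k) (hk : (k : ℕ) < Module.finrank 𝕜 C) {v : V} (hv : v ∈ C)
    (hv0 : v ≠ 0) : ‖⟪w j, v⟫_𝕜‖ ^ 2 < ‖v‖ ^ 2 / q := by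
  have hpos := hlam.pos_of_lt (by linarith) hjk
  have : 0 < ‖v‖ ^ 2 := by positivity
  have he : e < lam j / q :=
    (hC.le_of_lt_finrank hA (hlam.antitone hq) hk).trans_lt (hlam.lt_div hq hjk)
  refine lt_of_mul_lt_mul_left ?_ (hpos j).le
  calc lam j * ‖⟪w j, v⟫_𝕜‖ ^ 2
      ≤ ∑ i, lam i * ‖⟪w i, v⟫_𝕜‖ ^ 2 :=
        Finset.single_le_sum (f := fun i => lam i * ‖⟪w i, v⟫_𝕜‖ ^ 2)
          (fun i _ => mul_nonneg (hpos i).le (sq_nonneg _)) (Finset.mem_univ j)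
    _ = e * ‖v‖ ^ 2 := hC.sum_mul_norm_inner_sq_eq hA hv
    _ < lam j / q * ‖v‖ ^ 2 := by gcongr
    _ = lam j * (‖v‖ ^ 2 / q) := by ring

end CompressesToScalar

end Eigenbasis

section Coloring

theorem finrank_sup_id_le_sum {K M : Type*} [Field K] [AddCommGroup M] [Module K M]
    [FiniteDimensional K M] (T : Finset (Submodule K M)) :
    Module.finrank K (T.sup id : Submodule K M) ≤ ∑ D ∈ T, Module.finrank K D := by
  classical
  induction T using Finset.induction_on with
  | empty => simp
  | insert D T hD ih =>
    rw [Finset.sup_insert, Finset.sum_insert hD]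
    exact (Submodule.finrank_add_le_finrank_add_finrank _ _).trans (by simpa using ih)

variable {𝕜 V : Type*} [RCLike 𝕜] [NormedAddCommGroup V] [InnerProductSpace 𝕜 V]
  [FiniteDimensional 𝕜 V]

theorem finrank_le_sum_of_sum_starProjection {K : Finset (Submodule 𝕜 V)}
    (hK : ∀ v, ∑ C ∈ K, C.starProjection v = v) :
    Module.finrank 𝕜 V ≤ ∑ C ∈ K, Module.finrank 𝕜 C := by
  have htop : K.sup id = (⊤ : Submodule 𝕜 V) := eq_top_iff.mpr fun v _ => by
    rw [← hK v]
    exact Submodule.sum_mem _ fun C hC =>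
      (Finset.le_sup (f := id) hC : C ≤ _) (C.starProjection_apply_mem v)
  rw [← finrank_top 𝕜 V, ← htop]
  exact finrank_sup_id_le_sum K

theorem sum_norm_starProjection_sq {K : Finset (Submodule 𝕜 V)} {v : V}
    (hv : ∑ C ∈ K, C.starProjection v = v) : ∑ C ∈ K, ‖C.starProjection v‖ ^ 2 = ‖v‖ ^ 2 := by
  have hC (C : Submodule 𝕜 V) :
      ‖C.starProjection v‖ ^ 2 = RCLike.re ⟪C.starProjection v, v⟫_𝕜 := by
    rw [C.re_inner_starProjection_eq_normSq, Submodule.starProjection_apply, Submodule.coe_norm]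
  simp only [hC, ← map_sum, ← sum_inner, hv, inner_self_eq_norm_sq]

variable {n : ℕ} {w : OrthonormalBasis (Fin n) 𝕜 V} {A : V →ₗ[𝕜] V} {lam : Fin n → ℝ}

theorem sum_mul_norm_inner_sq_le_card_mul (hA : ∀ j, A (w j) = (lam j : 𝕜) • w j)
    (hlam : ∀ j, 0 ≤ lam j) {S : Finset (Submodule 𝕜 V)} {ε : Submodule 𝕜 V → ℝ} {e : ℝ}
    (hS : ∀ C ∈ S, CompressesToScalar A C (ε C)) (hε : ∀ C ∈ S, ε C ≤ e) {v : V}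
    (hv : ∑ C ∈ S, C.starProjection v = v) :
    ∑ j, lam j * ‖⟪w j, v⟫_𝕜‖ ^ 2 ≤ S.card * (e * ‖v‖ ^ 2) := by
  calc ∑ j, lam j * ‖⟪w j, v⟫_𝕜‖ ^ 2
      = ∑ j, lam j * ‖⟪w j, ∑ C ∈ S, C.starProjection v⟫_𝕜‖ ^ 2 := by rw [hv]
    _ ≤ S.card * ∑ C ∈ S, ∑ j, lam j * ‖⟪w j, C.starProjection v⟫_𝕜‖ ^ 2 :=
        sum_mul_norm_inner_sum_sq_le hlam S _
    _ ≤ S.card * ∑ C ∈ S, e * ‖C.starProjection v‖ ^ 2 := by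
        gcongr with C hC
        rw [(hS C hC).sum_mul_norm_inner_sq_eq hA (C.starProjection_apply_mem v)]
        exact mul_le_mul_of_nonneg_right (hε C hC) (sq_nonneg _)
    _ = S.card * (e * ‖v‖ ^ 2) := by rw [← Finset.mul_sum, sum_norm_starProjection_sq hv]

theorem exists_ne_zero_sum_sdiff_starProjection_eq [DecidableEq (Submodule 𝕜 V)]
    (w : OrthonormalBasis (Fin n) 𝕜 V) {K T : Finset (Submodule 𝕜 V)} (hTK : T ⊆ K)
    (hsum : ∀ v, ∑ C ∈ K, C.starProjection v = v) {a : Fin n}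
    (ha : ∑ D ∈ T, Module.finrank 𝕜 D ≤ a) :
    ∃ v ≠ 0, ∑ C ∈ K \ T, C.starProjection v = v ∧ ∀ j > a, ⟪w j, v⟫_𝕜 = 0 := by
  have hn : Module.finrank 𝕜 V = n := by simpa using Module.finrank_eq_card_basis w.toBasis
  have hT := finrank_sup_id_le_sum T
  have hT' := (T.sup id).finrank_add_finrank_orthogonal
  obtain ⟨v, hvT, hv0, hva⟩ := exists_mem_ne_zero_forall_inner_eq_zero w (s := Finset.Ioi a)
    (C := (T.sup id)ᗮ) (by rw [Fin.card_Ioi]; omega)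
  refine ⟨v, hv0, ?_, fun j hj => hva j (Finset.mem_Ioi.mpr hj)⟩
  have hzero : ∑ D ∈ T, D.starProjection v = 0 :=
    Finset.sum_eq_zero fun D hD => D.starProjection_apply_eq_zero_iff.mpr
      (Submodule.orthogonal_le (Finset.le_sup (f := id) hD) hvT)
  rw [← add_zero (∑ C ∈ K \ T, _), ← hzero, Finset.sum_sdiff hTK, hsum]

/- Let `C` have the largest value `e` among the codes outside of `T`. If its dimension exceeds
`s + 1` with `s = ∑ D ∈ T, finrank D`, then `e` is far below `lam s`. But some nonzero vector `v` in
the span of `w 0, …, w s` is orthogonal to all codes in `T`, hence a sum of vectors from the other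
codes, so that its quadratic form is at least `lam s * ‖v‖ ^ 2` and at most
`#(K \ T) * e * ‖v‖ ^ 2`. -/
theorem exists_finrank_le_sum_finrank_add_one [DecidableEq (Submodule 𝕜 V)]
    (hA : ∀ j, A (w j) = (lam j : 𝕜) • w j) {q : ℝ} (hlam : IsTropical q lam)
    {K T : Finset (Submodule 𝕜 V)} (hKq : K.card ≤ q) (hTK : T ⊂ K)
    (hK : ∀ C ∈ K, ∃ e, CompressesToScalar A C e)
    (hsum : ∀ v, ∑ C ∈ K, C.starProjection v = v) :
    ∃ C ∈ K \ T, Module.finrank 𝕜 C ≤ ∑ D ∈ T, Module.finrank 𝕜 D + 1 := by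
  choose! ε hε using hK
  obtain ⟨C, hC, hmax⟩ := Finset.exists_max_image (K \ T) ε (Finset.sdiff_nonempty.mpr hTK.2)
  have hCK := (Finset.mem_sdiff.mp hC).1
  refine ⟨C, hC, ?_⟩
  by_contra! hlt
  have hn : Module.finrank 𝕜 V = n := by simpa using Module.finrank_eq_card_basis w.toBasis
  have hCn : Module.finrank 𝕜 C ≤ n := hn ▸ C.finrank_le
  let a : Fin n := ⟨∑ D ∈ T, Module.finrank 𝕜 D, by omega⟩
  let b : Fin n := ⟨a + 1, hlt.trans_le hCn⟩
  have hab : a < b := Nat.lt_succ_self a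
  have hq : 1 ≤ q := le_trans (mod_cast Finset.card_pos.mpr ⟨C, hCK⟩) hKq
  have hpos := hlam.pos_of_lt (by linarith) hab
  have hεC : ε C < lam a / q :=
    ((hε C hCK).le_of_lt_finrank hA (hlam.antitone hq) hlt).trans_lt (hlam.lt_div hq hab)
  obtain ⟨v, hv0, hvsum, hva⟩ := exists_ne_zero_sum_sdiff_starProjection_eq w hTK.1 hsum (le_refl a)
  have hlower : lam a * ‖v‖ ^ 2 ≤ ∑ j, lam j * ‖⟪w j, v⟫_𝕜‖ ^ 2 :=
    le_sum_mul_norm_inner_sq fun j hj => hlam.antitone hq (not_lt.mp fun haj => hj (hva j haj))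
  have hupper := sum_mul_norm_inner_sq_le_card_mul hA (fun j => (hpos j).le)
    (fun D hD => hε D (Finset.mem_sdiff.mp hD).1) hmax hvsum
  have hv2 : 0 < ‖v‖ ^ 2 := by positivity
  have hle : lam a ≤ (K \ T).card * ε C :=
    le_of_mul_le_mul_right ((hlower.trans hupper).trans_eq (mul_assoc _ _ _).symm) hv2
  have hcard : ((K \ T).card : ℝ) ≤ q :=
    le_trans (mod_cast Finset.card_le_card Finset.sdiff_subset) hKq
  have hεC0 : 0 < ε C := pos_of_mul_pos_right ((hpos a).trans_le hle) (Nat.cast_nonneg _)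
  rw [lt_div_iff₀' (by linarith)] at hεC
  exact hεC.not_ge (hle.trans (mul_le_mul_of_nonneg_right hcard hεC0.le))

theorem sum_lt_two_pow_card {α : Type*} [DecidableEq α] (d : α → ℕ) {K : Finset α}
    (h : ∀ T ⊂ K, ∃ C ∈ K \ T, d C ≤ ∑ D ∈ T, d D + 1) : ∑ D ∈ K, d D < 2 ^ K.card := by
  have key : ∀ i ≤ K.card, ∃ T ⊆ K, T.card = i ∧ ∑ D ∈ T, d D < 2 ^ i := by
    intro i
    induction i with
    | zero => exact fun _ => ⟨∅, by simp⟩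
    | succ i ih =>
      intro hi
      obtain ⟨T, hTK, hTi, hT⟩ := ih (by omega)
      obtain ⟨C, hC, hCT⟩ := h T (hTK.ssubset_of_ne fun hEq => by rw [hEq] at hTi; omega)
      obtain ⟨hCK, hCn⟩ := Finset.mem_sdiff.mp hC
      refine ⟨insert C T, Finset.insert_subset hCK hTK, ?_, ?_⟩
      · rw [Finset.card_insert_of_notMem hCn, hTi]
      · rw [Finset.sum_insert hCn, pow_succ]
        omega
  obtain ⟨T, hTK, hTc, hT⟩ := key _ le_rfl
  rwa [Finset.eq_of_subset_of_card_le hTK hTc.ge] at hT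

theorem lt_two_pow_card_of_sum_starProjection (hA : ∀ j, A (w j) = (lam j : 𝕜) • w j) {q : ℝ}
    (hnq : n ≤ q) (hlam : IsTropical q lam) {K : Finset (Submodule 𝕜 V)}
    (hK : ∀ C ∈ K, ∃ e, CompressesToScalar A C e)
    (hsum : ∀ v, ∑ C ∈ K, C.starProjection v = v) : n < 2 ^ K.card := by
  classical
  rcases le_or_gt K.card n with hcard | hcard
  · have hn : Module.finrank 𝕜 V = n := by simpa using Module.finrank_eq_card_basis w.toBasis
    have hKq : K.card ≤ q := le_trans (mod_cast hcard) hnq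
    exact (hn ▸ finrank_le_sum_of_sum_starProjection hsum).trans_lt <| sum_lt_two_pow_card _
      fun T hT => exists_finrank_le_sum_finrank_add_one hA hlam hKq hT hK hsum
  · exact hcard.trans Nat.lt_two_pow_self

end Coloring

section Blocks

variable {n m : ℕ}

/-- The starting point of the block of index `i`, for the partition of `{0, …, n - 1}` into `m`
consecutive blocks whose first `n % m` members have size `n / m + 1` and the others `n / m`. -/
def blockStart (n m i : ℕ) : ℕ := i * (n / m) + min i (n % m)

/-- The total cyclic shift `blockStart n m i` between the `i`-th eigenbasis and the first one of a
graph `Q_{n,m}`. -/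
def blockShift (n m : ℕ) [NeZero n] (i : Fin m) : Fin n := Fin.ofNat n (blockStart n m i)

/-- The cyclical condition on the eigenvectors of the graphs `Q_{n,m}`: the sequence of index
`i + 1` is the cyclic shift of the sequence of index `i` by the size of the block of index `i`. -/
def IsCyclical {α : Type*} (w : Fin m → Fin n → α) : Prop :=
  ∀ (i i' : Fin m) (j j' : Fin n), (i' : ℕ) = i + 1 →
    (j' : ℕ) = (j + n / m + if (i : ℕ) < n % m then 1 else 0) % n → w i' j = w i j'

theorem blockStart_zero (n m : ℕ) : blockStart n m 0 = 0 := by simp [blockStart]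

theorem blockStart_succ (n m i : ℕ) :
    blockStart n m (i + 1) = blockStart n m i + (n / m + if i < n % m then 1 else 0) := by
  unfold blockStart
  rw [add_mul, one_mul]
  split_ifs <;> omega

theorem blockStart_self (n : ℕ) (hm : 0 < m) : blockStart n m m = n := by
  rw [blockStart, min_eq_right (Nat.mod_lt n hm).le, Nat.div_add_mod]

theorem strictMono_blockStart (hm : 0 < m) (hmn : m ≤ n) : StrictMono (blockStart n m) :=
  strictMono_nat_of_lt_succ fun i => by
    have := Nat.div_pos hmn hm
    rw [blockStart_succ]
    omega

theorem exists_mem_block {k p : ℕ} (hp : p < blockStart n m k) :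
    ∃ i < k, blockStart n m i ≤ p ∧ p < blockStart n m (i + 1) := by
  induction k with
  | zero => simp [blockStart_zero] at hp
  | succ k ih =>
    by_cases h : p < blockStart n m k
    · obtain ⟨i, hi, h⟩ := ih h
      exact ⟨i, hi.trans k.lt_succ_self, h⟩
    · exact ⟨k, k.lt_succ_self, not_lt.mp h, hp⟩

theorem sum_block_tail_le {r : ℕ} (hm : 0 < m) (hr : n ≤ r * (m + 1)) :
    ∑ i ∈ Finset.range m, (blockStart n m (i + 1) - (blockStart n m i + r)) ≤ r := by
  rcases Nat.lt_or_ge (n / m) r with h | h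
  · rw [Finset.sum_eq_zero]
    · exact Nat.zero_le r
    · intro i _
      rw [blockStart_succ]
      split_ifs <;> omega
  · have hsum (k : ℕ) : ∑ i ∈ Finset.range k,
        (blockStart n m (i + 1) - (blockStart n m i + r)) + k * r = blockStart n m k := by
      induction k with
      | zero => simp [blockStart_zero]
      | succ k ih =>
        rw [Finset.sum_range_succ, blockStart_succ, ← ih, add_mul]
        omega
    have hsum_m := hsum m
    rw [blockStart_self n hm] at hsum_m
    linarith

variable [NeZero n]

theorem val_blockShift (hmn : m ≤ n) (i : Fin m) :
    (blockShift n m i : ℕ) = blockStart n m i := by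
  refine Nat.mod_eq_of_lt ?_
  calc blockStart n m i < blockStart n m m := strictMono_blockStart i.pos hmn i.2
    _ = n := blockStart_self n i.pos

theorem injective_blockShift (hmn : m ≤ n) : Function.Injective (blockShift n m) := by
  intro i j hij
  refine Fin.ext ((strictMono_blockStart i.pos hmn).injective ?_)
  rw [← val_blockShift hmn, ← val_blockShift hmn, hij]

/- The indices that are counted are those which are not among the first `r` of their block. -/
theorem card_filter_le_sub_blockShift_le {r : ℕ} (hm : 0 < m) (hr : n ≤ r * (m + 1)) :
    (Finset.univ.filter fun p : Fin n =>
      ∀ i, r ≤ ((p - blockShift n m i : Fin n) : ℕ)).card ≤ r := by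
  refine le_trans ?_ (sum_block_tail_le hm hr)
  simp only [← Nat.card_Ico]
  refine le_trans ?_ Finset.card_biUnion_le
  rw [← Finset.card_map Fin.valEmbedding]
  refine Finset.card_le_card fun x hx => ?_
  simp only [Finset.mem_map, Finset.mem_filter, Finset.mem_univ, true_and] at hx
  obtain ⟨p, hp, rfl⟩ := hx
  obtain ⟨i, hi, hle, hlt⟩ := exists_mem_block (k := m) (p.2.trans_eq (blockStart_self n hm).symm)
  have hval : (blockShift n m ⟨i, hi⟩ : ℕ) = blockStart n m i :=
    Nat.mod_eq_of_lt (hle.trans_lt p.2)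
  have hsub : r ≤ (p : ℕ) - blockStart n m i := by
    rw [← hval, ← Fin.sub_val_of_le (Fin.le_def.mpr (hval.trans_le hle))]
    exact hp ⟨i, hi⟩
  refine Finset.mem_biUnion.mpr ⟨i, Finset.mem_range.mpr hi, Finset.mem_Ico.mpr ⟨?_, hlt⟩⟩
  change _ ≤ (p : ℕ)
  omega

theorem add_blockShift_eq {i i' : Fin m} {j j' : Fin n} (hi : (i' : ℕ) = i + 1)
    (hj : (j' : ℕ) = (j + n / m + if (i : ℕ) < n % m then 1 else 0) % n) :
    j + blockShift n m i' = j' + blockShift n m i := by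
  ext
  simp only [blockShift, Fin.val_add, Fin.val_ofNat, hi, hj, blockStart_succ, Nat.mod_add_mod,
    Nat.add_mod_mod]
  congr 1
  ring

theorem isCyclical_add_blockShift {α : Type*} (f : Fin n → α) :
    IsCyclical fun (i : Fin m) j => f (j + blockShift n m i) :=
  fun _ _ _ _ hi hj => congrArg f (add_blockShift_eq hi hj)

theorem IsCyclical.eq_add_blockShift {α : Type*} {w : Fin m → Fin n → α} (h : IsCyclical w)
    (i : Fin m) (j : Fin n) : w i j = w ⟨0, i.pos⟩ (j + blockShift n m i) := by
  obtain ⟨i, hi⟩ := i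
  induction i generalizing j with
  | zero => simp [blockShift, blockStart_zero]
  | succ i ih =>
    let j' : Fin n := ⟨_, Nat.mod_lt (j + n / m + if i < n % m then 1 else 0) (NeZero.pos n)⟩
    rw [h ⟨i, by omega⟩ ⟨i + 1, hi⟩ j j' rfl rfl, ih,
      add_blockShift_eq (i := ⟨i, by omega⟩) (i' := ⟨i + 1, hi⟩) (j' := j') rfl rfl]

end Blocks

section Cyclical

variable {𝕜 V : Type*} [RCLike 𝕜] [NormedAddCommGroup V] [InnerProductSpace 𝕜 V]

theorem IsCyclical.exists_orthonormalBasis [FiniteDimensional 𝕜 V] {n m : ℕ} [NeZero n]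
    (hV : Module.finrank 𝕜 V = n) {w : Fin m → OrthonormalBasis (Fin n) 𝕜 V}
    (hw : IsCyclical fun i j => w i j) :
    ∃ u : OrthonormalBasis (Fin n) 𝕜 V, ∀ i j, w i j = u (j + blockShift n m i) := by
  rcases Nat.eq_zero_or_pos m with rfl | hm
  · exact ⟨(stdOrthonormalBasis 𝕜 V).reindex (finCongr hV), fun i => i.elim0⟩
  · exact ⟨w ⟨0, hm⟩, hw.eq_add_blockShift⟩

theorem exists_norm_sq_div_le_norm_inner_sq {ι : Type*} [Fintype ι] (u : OrthonormalBasis ι 𝕜 V)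
    {S : Finset ι} {C : Submodule 𝕜 V} (hS : S.card < Module.finrank 𝕜 C) :
    ∃ v ∈ C, v ≠ 0 ∧ ∃ p ∉ S, ‖v‖ ^ 2 / Fintype.card ι ≤ ‖⟪u p, v⟫_𝕜‖ ^ 2 := by
  obtain ⟨v, hvC, hv0, hv⟩ := exists_mem_ne_zero_forall_inner_eq_zero u hS
  have hv2 : 0 < ‖v‖ ^ 2 := by positivity
  have hι : Nonempty ι := by
    by_contra! hι
    simp [← u.sum_sq_norm_inner_right v] at hv2
  have hcard : 0 < (Fintype.card ι : ℝ) := by exact_mod_cast Fintype.card_pos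
  refine ⟨v, hvC, hv0, ?_⟩
  by_contra! hlt
  have hall : ∀ p, ‖⟪u p, v⟫_𝕜‖ ^ 2 < ‖v‖ ^ 2 / Fintype.card ι := by
    intro p
    by_cases hp : p ∈ S
    · rw [hv p hp, norm_zero, zero_pow two_ne_zero]
      positivity
    · exact hlt p hp
  have hsum := Finset.sum_lt_sum_of_nonempty Finset.univ_nonempty fun p _ => hall p
  rw [u.sum_sq_norm_inner_right, Finset.sum_const, Finset.card_univ, nsmul_eq_mul,
    mul_div_cancel₀ _ hcard.ne'] at hsum
  exact hsum.false

variable {n m r : ℕ} [NeZero n] {u : OrthonormalBasis (Fin n) 𝕜 V} {A : Fin m → V →ₗ[𝕜] V}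
  {lam : Fin m → Fin n → ℝ}

theorem finrank_le_of_isTropical_of_blockShift (hr : n ≤ r * (m + 1))
    (hA : ∀ i p, A i (u p) = (lam i (p - blockShift n m i) : 𝕜) • u p) {q : ℝ} (hnq : n ≤ q)
    (hlam : ∀ i, IsTropical q (lam i)) {C : Submodule 𝕜 V}
    (hC : ∀ i, ∃ e, CompressesToScalar (A i) C e) : Module.finrank 𝕜 C ≤ r := by
  have hCn : Module.finrank 𝕜 C ≤ n := by
    have := u.toBasis.finiteDimensional_of_finite
    simpa using C.finrank_le.trans_eq (Module.finrank_eq_card_basis u.toBasis)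
  rcases Nat.eq_zero_or_pos m with rfl | hm
  · omega
  by_contra! hlt
  obtain ⟨v, hvC, hv0, p, hp, hle⟩ := exists_norm_sq_div_le_norm_inner_sq u
    ((card_filter_le_sub_blockShift_le hm hr).trans_lt hlt)
  obtain ⟨i, hi⟩ : ∃ i, ((p - blockShift n m i : Fin n) : ℕ) < r := by simpa using hp
  obtain ⟨e, he⟩ := hC i
  have hn : (1 : ℝ) ≤ n := by exact_mod_cast NeZero.one_le
  have hlt := he.norm_inner_sq_lt (w := u.reindex (Equiv.subRight (blockShift n m i)))
    (fun j => by simp [hA]) (hn.trans hnq) (hlam i) (k := ⟨r, hlt.trans_le hCn⟩)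
    (Fin.lt_def.mpr hi) hlt hvC hv0
  simp only [OrthonormalBasis.reindex_apply, Equiv.subRight_symm_apply, sub_add_cancel] at hlt
  rw [Fintype.card_fin] at hle
  exact (hle.trans_lt hlt).not_ge (by gcongr)

end Cyclical

section Diagonal

variable {V ι : Type*} [NormedAddCommGroup V] [InnerProductSpace ℂ V] [Fintype ι] [DecidableEq ι]
  (b : OrthonormalBasis ι ℂ V)

/-- The operators with real eigenvalues in the orthonormal basis `b`, as functions of the tuple of
eigenvalues. -/
noncomputable def diagonalOperator : (ι → ℝ) →ₐ[ℝ] Module.End ℂ V :=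
  ((Matrix.toLinAlgEquiv b.toBasis).toAlgHom.restrictScalars ℝ).comp
    (((Matrix.diagonalAlgHom ℂ).restrictScalars ℝ).comp (Complex.ofRealAm.compLeft ι))

theorem diagonalOperator_apply_basis (d : ι → ℝ) (p : ι) :
    diagonalOperator b d (b p) = (d p : ℂ) • b p := by
  have h := Matrix.toLinAlgEquiv_self b.toBasis (Matrix.diagonal fun i => (d i : ℂ)) p
  change Matrix.toLinAlgEquiv b.toBasis (Matrix.diagonal fun i => (d i : ℂ)) (b p) = _
  simpa [Matrix.diagonal_apply] using h

theorem diagonalOperator_injective : Function.Injective (diagonalOperator b) :=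
  (Matrix.toLinAlgEquiv b.toBasis).injective.comp
    (Matrix.diagonal_injective.comp Complex.ofReal_injective.comp_left)

theorem isSymmetric_diagonalOperator (d : ι → ℝ) : (diagonalOperator b d).IsSymmetric :=
  (Matrix.isSymmetric_toLin_iff b).mpr
    (Matrix.isHermitian_diagonal_of_self_adjoint _ (funext fun i => Complex.conj_ofReal (d i)))

end Diagonal

section Geometric

theorem isTropical_pow {n : ℕ} {q t : ℝ} (ht : 0 < t) (htq : t < 1 / q) :
    IsTropical q fun j : Fin n => t ^ (j : ℕ) := by
  intro j j' h
  refine ⟨by positivity, ?_⟩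
  dsimp only
  rw [h, pow_succ, div_eq_mul_one_div]
  gcongr

theorem linearIndependent_cons_const_single {K ι : Type*} [Field K] [DecidableEq ι] {m : ℕ}
    {s : Fin m → ι} (hs : Function.Injective s) {p : ι} (hp : p ∉ Set.range s) {a c : K}
    (ha : a ≠ 0) (hc : c ≠ 0) :
    LinearIndependent K (Fin.cons (fun _ => a) fun i => Pi.single (s i) c :
      Fin (m + 1) → ι → K) := by
  refine linearIndependent_finCons.mpr
    ⟨(Pi.linearIndependent_single_of_ne_zero fun _ => hc).comp s hs, fun hmem => ha ?_⟩
  have hker : Submodule.span K (Set.range fun i => (Pi.single (s i) c : ι → K)) ≤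
      LinearMap.ker (LinearMap.proj (R := K) (φ := fun _ : ι => K) p) := by
    rw [Submodule.span_le]
    rintro _ ⟨i, rfl⟩
    exact Pi.single_eq_of_ne (M := fun _ => K) (fun h => hp ⟨i, h.symm⟩) c
  exact hker hmem

variable {n m : ℕ} [NeZero n]

theorem pow_val_sub_mul_pow_val_sub_one (t : ℝ) (q : Fin n) :
    t ^ (q : ℕ) - t * t ^ ((q - 1 : Fin n) : ℕ) = if q = 0 then 1 - t ^ n else 0 := by
  obtain ⟨k, rfl⟩ := Nat.exists_eq_succ_of_ne_zero (NeZero.ne n)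
  rw [← pow_succ']
  split_ifs with hq
  · simp [hq, Fin.coe_neg_one]
  · have hq0 : 0 < (q : ℕ) := Nat.pos_of_ne_zero fun h => hq (Fin.ext (by simpa using h))
    rw [Fin.val_sub_one_of_ne_zero hq, Nat.sub_add_cancel hq0, sub_self]

/- The operator `f ↦ (p ↦ f p - t * f (p - 1))` maps the `i`-th progression to a multiple of the
`s i`-th standard basis vector. -/
theorem linearIndependent_cons_one_pow (hmn : m < n) {s : Fin m → Fin n}
    (hs : Function.Injective s) {t : ℝ} (ht0 : 0 ≤ t) (ht1 : t < 1) :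
    LinearIndependent ℝ
      (Fin.cons 1 fun i p => t ^ ((p - s i : Fin n) : ℕ) : Fin (m + 1) → Fin n → ℝ) := by
  obtain ⟨p, hp⟩ : ∃ p, p ∉ Set.range s := by
    by_contra! h
    have := Fintype.card_le_of_surjective s h
    simp at this
    omega
  have htn : t ^ n < 1 := pow_lt_one₀ ht0 ht1 (NeZero.ne n)
  let D : (Fin n → ℝ) →ₗ[ℝ] (Fin n → ℝ) := LinearMap.id - t • LinearMap.funLeft ℝ ℝ (· - 1)
  have hD : (D ∘ Fin.cons 1 fun i p => t ^ ((p - s i : Fin n) : ℕ)) =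
      (Fin.cons (fun _ => 1 - t) fun i => Pi.single (s i) (1 - t ^ n) :
        Fin (m + 1) → Fin n → ℝ) := by
    refine funext fun k => funext fun x => ?_
    induction k using Fin.cases with
    | zero => simp [D]
    | succ i =>
      have h := pow_val_sub_mul_pow_val_sub_one t (x - s i)
      rw [sub_right_comm] at h
      simpa [D, sub_eq_zero, Pi.single_apply] using h
  refine LinearIndependent.of_comp D ?_
  rw [hD]
  exact linearIndependent_cons_const_single hs hp (sub_pos.mpr ht1).ne' (sub_pos.mpr htn).ne'

end Geometric

theorem exists_eq_span_pair_of_finrank_eq_two {K M : Type*} [Field K] [AddCommGroup M] [Module K M]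
    {E : Submodule K M} (hE : Module.finrank K E = 2) {x : M} (hx : x ∈ E) (hx0 : x ≠ 0) :
    ∃ y ∈ E, Submodule.span K {x, y} = E := by
  have hfin : FiniteDimensional K E := Module.finite_of_finrank_pos (by omega)
  obtain ⟨y, hy, hyx⟩ : ∃ y ∈ E, y ∉ Submodule.span K {x} := by
    by_contra! h
    have hle := Submodule.finrank_mono (show E ≤ _ from h)
    rw [finrank_span_singleton hx0] at hle
    omega
  have hli : LinearIndependent K ![x, y] := (LinearIndependent.pair_iff' hx0).mpr fun a ha =>
    hyx (Submodule.mem_span_singleton.mpr ⟨a, ha⟩)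
  refine ⟨y, hy, Submodule.eq_of_le_of_finrank_eq ?_ ?_⟩
  · exact Submodule.span_le.mpr (Set.insert_subset hx (Set.singleton_subset_iff.mpr hy))
  · rw [hE, ← Matrix.range_cons_cons_empty x y ![], finrank_span_eq_card hli, Fintype.card_fin]

/-- The real vector space of the operators whose compression to `C` is a real scalar. The subspace
`C` is a code if and only if it contains the edge space. -/
def scalarCompressions {V : Type*} [NormedAddCommGroup V] [InnerProductSpace ℂ V]
    (C : Submodule ℂ V) : Submodule ℝ (V →ₗ[ℂ] V) where
  carrier := {A | ∃ e, CompressesToScalar A C e}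
  zero_mem' := ⟨0, fun x _ y _ => by simp⟩
  add_mem' := by
    rintro A B ⟨e, he⟩ ⟨f, hf⟩
    refine ⟨e + f, fun x hx y hy => ?_⟩
    rw [LinearMap.add_apply, inner_add_right, he x hx y hy, hf x hx y hy, ← add_mul]
    norm_cast
  smul_mem' := by
    rintro c A ⟨e, he⟩
    refine ⟨c * e, fun x hx y hy => ?_⟩
    rw [LinearMap.smul_apply, ← Complex.coe_smul, inner_smul_right, he x hx y hy, ← mul_assoc,
      RCLike.ofReal_mul]
    rfl

namespace QuantumGraph

section Codes

variable {G : QuantumGraph.{u}} {C : Submodule ℂ G.V}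

theorem isCode_iff_le_scalarCompressions : G.IsCode C ↔ G.E ≤ scalarCompressions C := by
  constructor
  · rintro ⟨ε, h⟩ A hA
    refine ⟨ε ⟨A, hA⟩, fun x hx y hy => ?_⟩
    have hxy := congrArg (fun q => ⟪x, q⟫_ℂ) (LinearMap.congr_fun (h ⟨A, hA⟩) y)
    have hx' := Submodule.starProjection_eq_self_iff.mpr hx
    have hy' := Submodule.starProjection_eq_self_iff.mpr hy
    simpa [proj, hy', ← Submodule.inner_starProjection_left_eq_right, hx', inner_smul_right]
      using hxy
  · intro h
    choose ε hε using fun A : G.E => h A.2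
    refine ⟨ε, fun A => LinearMap.ext fun v => ext_inner_left ℂ fun x => ?_⟩
    have hxv := hε A _ (C.starProjection_apply_mem x) _ (C.starProjection_apply_mem v)
    rw [Submodule.inner_starProjection_left_eq_right,
      Submodule.inner_starProjection_left_eq_right,
      Submodule.starProjection_eq_self_iff.mpr (C.starProjection_apply_mem v)] at hxv
    simpa [proj, inner_smul_right, -Complex.coe_smul] using hxv

theorem isCode_iff_of_span_insert_eq {S : Set (G.V →ₗ[ℂ] G.V)}
    (hS : Submodule.span ℝ (insert LinearMap.id S) = G.E) :
    G.IsCode C ↔ ∀ A ∈ S, ∃ e, CompressesToScalar A C e := by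
  have hid : LinearMap.id ∈ scalarCompressions C := ⟨1, fun x _ y _ => by simp⟩
  rw [isCode_iff_le_scalarCompressions, ← hS, Submodule.span_le, Set.insert_subset_iff,
    and_iff_right (SetLike.mem_coe.mpr hid)]
  rfl

theorem isColoring_iff {K : Finset (Submodule ℂ G.V)} :
    G.IsColoring K ↔ (∀ C ∈ K, G.IsCode C) ∧ ∀ v, ∑ C ∈ K, C.starProjection v = v := by
  simp [IsColoring, proj, LinearMap.ext_iff, LinearMap.sum_apply]

end Codes

theorem exists_isColoring_card_le_slog {G : QuantumGraph.{u}} (hG : G.valence = 1) :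
    ∃ K, G.IsColoring K ∧ K.card ≤ slog G.order 2 := by
  have hE : Module.finrank ℝ G.E = 2 := by
    unfold valence at hG
    omega
  have hid : (LinearMap.id : G.V →ₗ[ℂ] G.V) ≠ 0 := fun h => by
    have hbot : G.E = ⊥ := (Submodule.eq_bot_iff _).mpr fun A _ => by
      rw [← A.comp_id, h, LinearMap.comp_zero]
    rw [hbot, finrank_bot] at hE
    omega
  obtain ⟨A, hA, hspan⟩ := exists_eq_span_pair_of_finrank_eq_two hE G.id_mem hid
  obtain ⟨K, hK, hKe, hsum⟩ :=
    exists_sum_starProjection_eq_card_le_slog (G.isSymmetric_of_mem A hA) ⊤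
  rw [finrank_top] at hK
  refine ⟨K, isColoring_iff.mpr ⟨fun C hC => ?_, fun v => ?_⟩, hK⟩
  · simpa [isCode_iff_of_span_insert_eq hspan] using (hKe C hC).2
  · simpa [Submodule.starProjection_top] using congr($hsum v)

theorem chromaticNumber_le_slog {G : QuantumGraph.{u}} (hG : G.valence = 1) :
    G.chromaticNumber ≤ slog G.order 2 := by
  obtain ⟨K, hK, hcard⟩ := exists_isColoring_card_le_slog hG
  exact le_trans (Nat.sInf_le ⟨K, hK, rfl⟩) hcard

namespace IsQ

variable {G : QuantumGraph.{u}} {n m : ℕ}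

theorem pos (h : G.IsQ n m) : 0 < n := by
  obtain ⟨hord, -, -, A, -, -, hli, -⟩ := h
  by_contra hn
  have hV : Subsingleton G.V :=
    Module.finrank_zero_iff.mp (hord.trans (Nat.eq_zero_of_not_pos hn))
  exact hli.ne_zero 0 (Subsingleton.elim _ _)

theorem exists_eigenbasis [NeZero n] (h : G.IsQ n m) :
    ∃ (u : OrthonormalBasis (Fin n) ℂ G.V) (A : Fin m → G.V →ₗ[ℂ] G.V) (lam : Fin m → Fin n → ℝ),
      Submodule.span ℝ (insert LinearMap.id (Set.range A)) = G.E ∧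
      (∀ i p, A i (u p) = (lam i (p - blockShift n m i) : ℂ) • u p) ∧
      ∀ i, IsTropical ((n : ℝ) ^ 2) (lam i) := by
  obtain ⟨hord, -, -, A, lam, w, -, hspan, hA, hlam, hw⟩ := h
  obtain ⟨u, hu⟩ := IsCyclical.exists_orthonormalBasis hord hw
  rw [Fin.range_cons] at hspan
  refine ⟨u, A, lam, hspan, fun i p => ?_, hlam⟩
  simpa [hu] using hA i (p - blockShift n m i)

theorem independenceNumber_eq (h : G.IsQ n m) :
    G.independenceNumber = ⌈(n : ℚ) / ((m : ℚ) + 1)⌉₊ := by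
  have : NeZero n := ⟨h.pos.ne'⟩
  obtain ⟨u, A, lam, hspan, hA, hlam⟩ := h.exists_eigenbasis
  have hm : (0 : ℚ) < m + 1 := by positivity
  obtain ⟨r, hr⟩ := Nat.exists_eq_succ_of_ne_zero
    (Nat.ceil_pos.mpr (div_pos (Nat.cast_pos.mpr h.pos) hm)).ne'
  have hlt : r * (m + 1) < n := by
    have := Nat.lt_ceil.mp (hr ▸ r.lt_succ_self)
    rw [lt_div_iff₀ hm] at this
    exact_mod_cast this
  have hle : n ≤ (r + 1) * (m + 1) := by
    have := Nat.ceil_le.mp hr.le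
    rw [div_le_iff₀ hm] at this
    exact_mod_cast this
  rw [hr]
  refine IsGreatest.csSup_eq ⟨?_, ?_⟩
  · obtain ⟨C, hC, hCe⟩ := exists_compressesToScalar_of_eigenbasis hA (by simpa using hlt)
    exact ⟨C, (isCode_iff_of_span_insert_eq hspan).mpr (Set.forall_mem_range.mpr hCe), hC⟩
  · rintro _ ⟨C, hC, rfl⟩
    exact finrank_le_of_isTropical_of_blockShift hle hA
      (mod_cast Nat.le_self_pow two_ne_zero n) hlam
      fun i => (isCode_iff_of_span_insert_eq hspan).mp hC _ ⟨i, rfl⟩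

theorem chromaticNumber_eq (h : G.IsQ n 1) : G.chromaticNumber = slog n 2 := by
  have : NeZero n := ⟨h.pos.ne'⟩
  obtain ⟨u, A, lam, hspan, hA, hlam⟩ := h.exists_eigenbasis
  obtain ⟨K₀, hK₀, -⟩ := exists_isColoring_card_le_slog h.2.1
  refine le_antisymm (h.1 ▸ chromaticNumber_le_slog h.2.1) (le_csInf ⟨_, K₀, hK₀, rfl⟩ ?_)
  rintro _ ⟨K, hK, rfl⟩
  obtain ⟨hcode, hsum⟩ := isColoring_iff.mp hK
  have hlt : n < 2 ^ K.card :=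
    lt_two_pow_card_of_sum_starProjection (w := u.reindex (Equiv.subRight (blockShift n 1 0)))
      (fun j => by simp [hA]) (mod_cast Nat.le_self_pow two_ne_zero n) (hlam 0)
      (fun C hC => (isCode_iff_of_span_insert_eq hspan).mp (hcode C hC) _ ⟨0, rfl⟩) hsum
  rw [slog_two_eq_log h.pos]
  exact Nat.log_lt_of_lt_pow h.pos.ne' hlt

end IsQ

section Existence

/-- The quantum graph whose edges are the operators that are diagonal in the orthonormal basis `b`
and whose tuple of eigenvalues lies in `L`. -/
noncomputable def diagonal {V : Type u} {ι : Type*} [NormedAddCommGroup V] [InnerProductSpace ℂ V]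
    [FiniteDimensional ℂ V] [Fintype ι] [DecidableEq ι] (b : OrthonormalBasis ι ℂ V)
    (L : Submodule ℝ (ι → ℝ)) (hL : 1 ∈ L) : QuantumGraph.{u} where
  V := V
  E := L.map (diagonalOperator b).toLinearMap
  isSymmetric_of_mem := by
    rintro _ ⟨d, -, rfl⟩
    exact isSymmetric_diagonalOperator b d
  id_mem := ⟨1, hL, map_one (diagonalOperator b)⟩

theorem isQ_diagonal {V : Type u} [NormedAddCommGroup V] [InnerProductSpace ℂ V]
    [FiniteDimensional ℂ V] {n m : ℕ} [NeZero n] (b : OrthonormalBasis (Fin n) ℂ V)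
    {lam : Fin m → Fin n → ℝ} (hlam : ∀ i, IsTropical ((n : ℝ) ^ 2) (lam i))
    (hli : LinearIndependent ℝ (Fin.cons 1 fun i p => lam i (p - blockShift n m i) :
      Fin (m + 1) → Fin n → ℝ)) :
    (diagonal b (Submodule.span ℝ (Set.range (Fin.cons 1 fun i p => lam i (p - blockShift n m i) :
      Fin (m + 1) → Fin n → ℝ))) (Submodule.subset_span ⟨0, rfl⟩)).IsQ n m := by
  set f : Fin (m + 1) → Fin n → ℝ := Fin.cons 1 fun i p => lam i (p - blockShift n m i)
  let D := (diagonalOperator b).toLinearMap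
  have hDf : (Fin.cons LinearMap.id fun i => D (f i.succ) : Fin (m + 1) → V →ₗ[ℂ] V) = D ∘ f := by
    refine funext fun k => Fin.cases ?_ (fun _ => rfl) k
    exact (map_one (diagonalOperator b)).symm
  have hspan : Submodule.span ℝ (Set.range (D ∘ f)) = (Submodule.span ℝ (Set.range f)).map D := by
    rw [Set.range_comp, Submodule.span_image]
  have hDli : LinearIndependent ℝ (D ∘ f) :=
    hli.map' D (LinearMap.ker_eq_bot.mpr (diagonalOperator_injective b))
  let w : Fin m → OrthonormalBasis (Fin n) ℂ V := fun i =>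
    b.reindex (Equiv.subRight (blockShift n m i))
  have hw (i j) : w i j = b (j + blockShift n m i) := by simp [w]
  refine ⟨?_, ?_, ?_, fun i => D (f i.succ), lam, w, ?_, ?_, fun i j => ?_, hlam,
    fun i i' j j' hi hj => ?_⟩
  · exact (Module.finrank_eq_card_basis b.toBasis).trans (Fintype.card_fin n)
  · have hrank := finrank_span_eq_card hDli
    rw [hspan, Fintype.card_fin] at hrank
    exact Nat.sub_eq_of_eq_add hrank
  · rintro _ ⟨d, -, rfl⟩ _ ⟨d', -, rfl⟩
    exact (Commute.all d d').map (diagonalOperator b)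
  · exact hDf ▸ hDli
  · exact hDf ▸ hspan
  · have h := diagonalOperator_apply_basis b (f i.succ) (j + blockShift n m i)
    simp only [f, Fin.cons_succ, add_sub_cancel_right, ← hw] at h
    exact h
  · exact (hw i' j).trans ((isCyclical_add_blockShift b i i' j j' hi hj).trans (hw i j').symm)

theorem exists_isQ {n m : ℕ} (hmn : m < n) : ∃ G : QuantumGraph.{u}, G.IsQ n m := by
  have : NeZero n := ⟨by omega⟩
  let b : OrthonormalBasis (Fin n) ℂ (EuclideanSpace ℂ (ULift.{u} (Fin n))) :=
    (EuclideanSpace.basisFun _ ℂ).reindex Equiv.ulift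
  have hn : (1 : ℝ) ≤ n := by exact_mod_cast NeZero.one_le
  let t : ℝ := 1 / ((n : ℝ) ^ 2 + 1)
  have ht0 : 0 < t := by positivity
  have htn : t < 1 / (n : ℝ) ^ 2 := one_div_lt_one_div_of_lt (by positivity) (lt_add_one _)
  have ht1 : t < 1 := htn.trans_le (div_le_one_of_le₀ (one_le_pow₀ hn) (by positivity))
  exact ⟨_, isQ_diagonal b (lam := fun _ j => t ^ (j : ℕ)) (fun _ => isTropical_pow ht0 htn)
    (linearIndependent_cons_one_pow hmn (injective_blockShift hmn.le) ht0.le ht1)⟩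

end Existence

theorem isGreatest_chromaticNumbers_one {n : ℕ} (hn : 2 ≤ n) :
    IsGreatest (chromaticNumbers.{u} n 1) (slog n 2) := by
  refine ⟨?_, ?_⟩
  · obtain ⟨G, hG⟩ := exists_isQ.{u} hn
    exact ⟨G, hG.1, hG.2.1, hG.chromaticNumber_eq⟩
  · rintro _ ⟨G, rfl, hval, rfl⟩
    exact chromaticNumber_le_slog hval

end QuantumGraph

theorem corollary1 :
    -- the graphs `Q_{n,m}` exist for all `0 ≤ m < n`, and each has independence number `⌈n/(m+1)⌉`
    (∀ n m : ℕ, m < n → ∃ G : QuantumGraph.{u}, G.IsQ n m) ∧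
    (∀ (n m : ℕ) (G : QuantumGraph.{u}), G.IsQ n m →
      G.independenceNumber = ⌈(n : ℚ) / ((m : ℚ) + 1)⌉₊) ∧
    -- the maximal chromatic number among graphs of order `n` and valence `1`
    (∀ n : ℕ, 2 ≤ n →
      IsGreatest (QuantumGraph.chromaticNumbers.{u} n 1) (slog n 2) ∧
      slog n 2 = ⌊Real.logb 2 (n : ℝ)⌋₊ + 1) ∧
    -- the maximum is attained by the graphs `Q_{n,1}`
    (∀ (n : ℕ) (G : QuantumGraph.{u}), G.IsQ n 1 → G.chromaticNumber = slog n 2) ∧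
    -- the chromatic number is unbounded on graphs of valence `1`
    (∀ k : ℕ, ∃ G : QuantumGraph.{u}, G.valence = 1 ∧ k < G.chromaticNumber) := by
  refine ⟨fun n m => QuantumGraph.exists_isQ, fun n m G hG => hG.independenceNumber_eq,
    fun n hn => ⟨QuantumGraph.isGreatest_chromaticNumbers_one hn, ?_⟩,
    fun n G hG => hG.chromaticNumber_eq, fun k => ?_⟩
  · have hlog : ⌊Real.logb 2 (n : ℝ)⌋₊ = Nat.log 2 n := mod_cast Real.natFloor_logb_natCast 2 n
    rw [slog_two_eq_log (by omega), hlog]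
  · obtain ⟨G, hG⟩ := QuantumGraph.exists_isQ.{u} (Nat.one_lt_two_pow k.succ_ne_zero)
    refine ⟨G, hG.2.1, ?_⟩
    rw [hG.chromaticNumber_eq, slog_two_eq_log (by positivity), Nat.log_pow one_lt_two]
    omega
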